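/- For a matrix $M\in\mathbb{R}^{m\times k}$ with nonnegative entries, let its nonnegative rank $\operatorname{rank}^+(M)$ be the smallest $s\in\mathbb{N}$ such that $M=AW$ for some entrywise nonnegative matrices $A\in\mathbb{R}^{m\times s}$ and $W\in\mathbb{R}^{s\times k}$. Theorem. For every $r\in\mathbb{N}$ and every integer $n\ge 2$ there is a $3rn\times 3rn$ real matrix $M$ with nonnegative entries such that $\operatorname{rank}^+(M)\ge 4r$, and yet for every set $I$ of fewer than $n$ rows, the submatrix of $M$ formed by the rows in $I$ (and all columns) has nonnegative rank at most $3r$. -/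

import Mathlib

/-- `M` has a nonnegative factorization of inner dimension `k`: `M = A * W` with `A` of size
`m × k`, `W` of size `k × n`, both entrywise nonnegative. -/
def HasNonnegFactorization {m n : Type*} (M : Matrix m n ℝ) (k : ℕ) : Prop :=
  ∃ (A : Matrix m (Fin k) ℝ) (W : Matrix (Fin k) n ℝ),
    (∀ i j, 0 ≤ A i j) ∧ (∀ i j, 0 ≤ W i j) ∧ M = A * W

/-- The nonnegative rank: the smallest inner dimension of a nonnegative factorization.
For an entrywise nonnegative matrix with finitely many columns such a factorization exists
(`hasNonnegFactorization_card`), so the infimum is an attained minimum. -/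
noncomputable def nonnegRank {m n : Type*} (M : Matrix m n ℝ) : ℕ :=
  sInf {k : ℕ | HasNonnegFactorization M k}

theorem hasNonnegFactorization_card {m n : Type*} [Fintype n] (M : Matrix m n ℝ)
    (hM : ∀ i j, 0 ≤ M i j) : HasNonnegFactorization M (Fintype.card n) := by
  classical
  refine ⟨M.submatrix id (Fintype.equivFin n).symm,
    (1 : Matrix n n ℝ).submatrix (Fintype.equivFin n).symm id, fun i j => hM _ _, ?_, ?_⟩
  · intro i j
    simp only [Matrix.submatrix_apply, Matrix.one_apply]
    split_ifs <;> norm_num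
  · rw [Matrix.submatrix_mul_equiv, Matrix.mul_one, Matrix.submatrix_id_id]

theorem hasNonnegFactorization_nonnegRank {m n : Type*} [Fintype n] (M : Matrix m n ℝ)
    (hM : ∀ i j, 0 ≤ M i j) : HasNonnegFactorization M (nonnegRank M) :=
  Nat.sInf_mem (s := {k : ℕ | HasNonnegFactorization M k}) ⟨_, hasNonnegFactorization_card M hM⟩

open Real Matrix

/-! Let N = 3n and c = cos(π/N). `polygonSlack N` holds the slacks of a regular N-gon of
circumradius 1 inside a concentric one of inradius 2c³. Nonnegative rank 3 would put a triangle
between them, hence between discs of radii c and 2c², against Euler's R ≥ 2r;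
`not_hasNonnegFactorization_polygonSlack_three` does this algebraically. Fewer than n rows miss a
residue class mod n of outer sides, and without that class an equilateral triangle of inradius c and
circumradius 2c fits (`exists_factorization_polygonSlack`). Taking r diagonal blocks gives 4r
against 3r, since a nonnegative rank-one term meets at most one diagonal block. -/

/-! ### Trigonometric polynomials of degree one on a regular polygon. -/

theorem exists_fin_cos_ge {N : ℕ} (hN : 0 < N) (φ : ℝ) :
    ∃ i : Fin N, cos (π / N) ≤ cos (2 * π * i / N + φ) := by
  have hN' : (0 : ℝ) < N := by exact_mod_cast hN
  -- The multiple of 2π/N nearest to -φ is within π/N of it.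
  set m : ℤ := round (-φ * N / (2 * π)) with hm
  have hNz : (0 : ℤ) < N := by exact_mod_cast hN
  have h0 : 0 ≤ m % N := Int.emod_nonneg _ hNz.ne'
  have h1 : m % N < N := Int.emod_lt_of_pos _ hNz
  refine ⟨⟨(m % N).toNat, by omega⟩, ?_⟩
  have hcast : (((m % N).toNat : ℕ) : ℝ) = m - N * ((m / N : ℤ) : ℝ) := by
    have h2 : (((m % N).toNat : ℕ) : ℤ) = m - N * (m / N) := by
      rw [Int.toNat_of_nonneg h0, Int.emod_def]
    exact_mod_cast h2
  have h3 : 2 * π * (((m % N).toNat : ℕ) : ℝ) / N + φ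
      = (2 * π * m / N + φ) - ((m / N : ℤ) : ℝ) * (2 * π) := by
    rw [hcast]
    field_simp
    ring
  simp only
  rw [h3, cos_sub_int_mul_two_pi, ← cos_abs (2 * π * m / N + φ)]
  have hr : |-φ * N / (2 * π) - m| ≤ 1 / 2 := abs_sub_round _
  have h4 : 2 * π * m / N + φ = -(2 * π / N) * (-φ * N / (2 * π) - m) := by
    field_simp
    ring
  have h5 : |2 * π * m / N + φ| ≤ π / N := by
    rw [h4, abs_mul, abs_neg, abs_of_pos (by positivity)]
    calc 2 * π / N * |-φ * N / (2 * π) - m| ≤ 2 * π / N * (1 / 2) := by gcongr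
      _ = π / N := by ring
  refine cos_le_cos_of_nonneg_of_le_pi (abs_nonneg _) ?_ h5
  exact div_le_self pi_pos.le (by exact_mod_cast hN)

/-- A trigonometric polynomial of degree one that is nonnegative on a regular `N`-gon of angles
has amplitude at most its mean divided by `cos (π / N)`. -/
theorem sqrt_mul_cos_le_of_nonneg {N : ℕ} (hN : 0 < N) {φ a b d : ℝ}
    (h : ∀ i : Fin N,
      0 ≤ a + b * cos (2 * π * i / N + φ) + d * sin (2 * π * i / N + φ)) :
    √(b ^ 2 + d ^ 2) * cos (π / N) ≤ a := by
  -- The argument of z is the angle at which the polynomial is least.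
  set z : ℂ := ⟨-b, -d⟩ with hz
  have hnorm : ‖z‖ = √(b ^ 2 + d ^ 2) := by
    rw [Complex.norm_def, Complex.normSq_mk]
    congr 1
    ring
  have hre : ‖z‖ * cos z.arg = -b := Complex.norm_mul_cos_arg z
  have him : ‖z‖ * sin z.arg = -d := Complex.norm_mul_sin_arg z
  obtain ⟨i, hi⟩ := exists_fin_cos_ge hN (φ - z.arg)
  have h1 := h i
  rw [show 2 * π * i / N + (φ - z.arg) = (2 * π * i / N + φ) - z.arg by ring, cos_sub] at hi
  have h2 := mul_le_mul_of_nonneg_left hi (norm_nonneg z)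
  rw [← hnorm]
  calc ‖z‖ * cos (π / N) ≤ _ := h2
    _ = (‖z‖ * cos z.arg) * cos (2 * π * i / N + φ)
        + (‖z‖ * sin z.arg) * sin (2 * π * i / N + φ) := by ring
    _ ≤ a := by rw [hre, him]; linarith

theorem mul_add_mul_le_sqrt_mul_sqrt (a b c d : ℝ) :
    a * c + b * d ≤ √(a ^ 2 + b ^ 2) * √(c ^ 2 + d ^ 2) := by
  rw [← sqrt_mul (by positivity)]
  apply le_sqrt_of_sq_le
  nlinarith [sq_nonneg (a * d - b * c)]

/-- Rows are `(1, cos θ, sin θ)` for `θ` in a regular `N`-gon of angles with offset `φ`. -/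
noncomputable def trigFrame (N : ℕ) (φ : ℝ) : Matrix (Fin N) (Fin 3) ℝ :=
  Matrix.of fun i => ![1, cos (2 * π * i / N + φ), sin (2 * π * i / N + φ)]

theorem trigFrame_mul_apply {N : ℕ} {κ : Type*} (φ : ℝ) (X : Matrix (Fin 3) κ ℝ)
    (i : Fin N) (l : κ) :
    (trigFrame N φ * X) i l =
      X 0 l + X 1 l * cos (2 * π * i / N + φ) + X 2 l * sin (2 * π * i / N + φ) := by
  simp [trigFrame, Matrix.mul_apply, Fin.sum_univ_three]
  ring

theorem cos_pi_div_pos {N : ℕ} (hN : 3 ≤ N) : 0 < cos (π / N) := by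
  have hN' : (3 : ℝ) ≤ N := by exact_mod_cast hN
  have h : π / N ≤ π / 3 := by gcongr
  have h0 : 0 < π / N := by positivity
  exact cos_pos_of_mem_Ioo ⟨by linarith [pi_pos], by linarith [pi_pos]⟩

/-- A kernel vector and its negative are both nonnegative on the polygon, so the amplitude bound
applied to each forces zero. -/
theorem exists_mul_trigFrame_eq_one {N : ℕ} (hN : 3 ≤ N) (φ : ℝ) :
    ∃ L : Matrix (Fin 3) (Fin N) ℝ, L * trigFrame N φ = 1 := by
  classical
  have hc := cos_pi_div_pos hN
  suffices hker : LinearMap.ker (toLin' (trigFrame N φ)) = ⊥ by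
    obtain ⟨g, hg⟩ := LinearMap.exists_leftInverse_of_injective _ hker
    refine ⟨LinearMap.toMatrix' g, ?_⟩
    rw [← LinearMap.toMatrix'_toLin' (trigFrame N φ), ← LinearMap.toMatrix'_comp, hg,
      LinearMap.toMatrix'_id]
  rw [LinearMap.ker_eq_bot']
  intro v hv
  have hv' : ∀ i : Fin N,
      v 0 + v 1 * cos (2 * π * i / N + φ) + v 2 * sin (2 * π * i / N + φ) = 0 := by
    intro i
    have := congrFun hv i
    simp [trigFrame, Matrix.mulVec, dotProduct, Fin.sum_univ_three] at this
    linarith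
  have h1 := sqrt_mul_cos_le_of_nonneg (by omega) fun i => (hv' i).ge
  have h2 := sqrt_mul_cos_le_of_nonneg (N := N) (φ := φ) (a := -v 0) (b := -v 1) (d := -v 2)
    (by omega) fun i => by linarith [hv' i]
  rw [neg_sq, neg_sq] at h2
  have h3 : 0 ≤ √(v 1 ^ 2 + v 2 ^ 2) * cos (π / N) := by positivity
  have h4 : √(v 1 ^ 2 + v 2 ^ 2) = 0 := by
    have : √(v 1 ^ 2 + v 2 ^ 2) * cos (π / N) = 0 := by linarith
    simpa [hc.ne'] using this
  rw [sqrt_eq_zero (by positivity)] at h4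
  ext k
  fin_cases k
  · simp only [Fin.zero_eta, Pi.zero_apply]; linarith
  · simp only [Fin.mk_one, Pi.zero_apply]; nlinarith [sq_nonneg (v 1), sq_nonneg (v 2)]
  · simp only [Fin.reduceFinMk, Pi.zero_apply]; nlinarith [sq_nonneg (v 1), sq_nonneg (v 2)]

/-- The slack matrix of a regular `N`-gon of points inside a concentric regular `N`-gon. -/
noncomputable def polygonSlack (N : ℕ) : Matrix (Fin N) (Fin N) ℝ :=
  Matrix.of fun i j =>
    2 * cos (π / N) ^ 3 + cos (2 * π * i / N - (2 * π * j / N - π / N))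

theorem polygonSlack_eq_mul (N : ℕ) :
    polygonSlack N = trigFrame N 0 * diagonal ![2 * cos (π / N) ^ 3, 1, 1] *
      (trigFrame N (-(π / N)))ᵀ := by
  ext i j
  rw [Matrix.mul_assoc, trigFrame_mul_apply]
  simp only [polygonSlack, Matrix.of_apply, cos_sub (2 * π * i / N), diagonal_mul, transpose_apply,
    trigFrame, add_zero]
  simp [← sub_eq_add_neg]
  ring

theorem polygonSlack_nonneg {N : ℕ} (hN : 6 ≤ N) (i j : Fin N) : 0 ≤ polygonSlack N i j := by
  have hN' : (6 : ℝ) ≤ N := by exact_mod_cast hN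
  have h : cos (π / 6) ≤ cos (π / N) :=
    cos_le_cos_of_nonneg_of_le_pi (by positivity) (by linarith [pi_pos]) (by gcongr)
  rw [cos_pi_div_six] at h
  have h3 : (0.85 : ℝ) ≤ √3 / 2 := by
    have : (1.7 : ℝ) ≤ √3 := le_sqrt_of_sq_le (by norm_num)
    linarith
  have h4 : (0.85 : ℝ) ^ 3 ≤ cos (π / N) ^ 3 := by gcongr; linarith
  have := neg_one_le_cos (2 * π * i / N - (2 * π * j / N - π / N))
  simp only [polygonSlack, Matrix.of_apply]
  norm_num at h4 ⊢
  linarith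

/-- Inner dimension 3 equals the rank, so `A = F * X` and `W = Y * Gᵀ` with `X * Y = D` and `Y * (E
* X) = 1`. Nonnegativity bounds the amplitudes in X and Y; by Cauchy–Schwarz each diagonal entry of
the second identity yields `hbound`. Summing against the (0,0) entry of the first forces c ≥ 1. -/
theorem not_hasNonnegFactorization_polygonSlack_three {N : ℕ} (hN : 3 ≤ N) :
    ¬ HasNonnegFactorization (polygonSlack N) 3 := by
  rintro ⟨A, W, hA, hW, hM⟩
  have hc := cos_pi_div_pos hN
  have hc1 : cos (π / N) < 1 := by
    have hN' : (3 : ℝ) ≤ N := by exact_mod_cast hN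
    rw [← cos_zero]
    have h0 : 0 < π / N := by positivity
    exact cos_lt_cos_of_nonneg_of_le_pi le_rfl
      (div_le_self pi_pos.le (by linarith)) h0
  set c := cos (π / N) with hcdef
  rw [polygonSlack_eq_mul] at hM
  set F := trigFrame N 0 with hF
  set G := trigFrame N (-(π / N)) with hG
  set D : Matrix (Fin 3) (Fin 3) ℝ := diagonal ![2 * c ^ 3, 1, 1] with hD
  set E : Matrix (Fin 3) (Fin 3) ℝ := diagonal ![(2 * c ^ 3)⁻¹, 1, 1] with hE
  have hDE : D * E = 1 := by
    rw [hD, hE, diagonal_mul_diagonal, ← diagonal_one]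
    congr 1
    ext k
    fin_cases k <;> simp
    field_simp
  have hED : E * D = 1 := mul_eq_one_comm.mp hDE
  obtain ⟨L, hL⟩ := exists_mul_trigFrame_eq_one hN 0
  obtain ⟨R, hR⟩ := exists_mul_trigFrame_eq_one hN (-(π / N))
  have hR' : Gᵀ * Rᵀ = 1 := by rw [← transpose_mul, hR, transpose_one]
  set X := L * A with hX
  set Y := W * Rᵀ with hY
  have hXW : X * W = D * Gᵀ := by
    rw [hX, Matrix.mul_assoc, ← hM, ← Matrix.mul_assoc, ← Matrix.mul_assoc, hL, Matrix.one_mul]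
  have hAY : A * Y = F * D := by
    rw [hY, ← Matrix.mul_assoc, ← hM, Matrix.mul_assoc, hR', Matrix.mul_one]
  have hXY : X * Y = D := by
    rw [hX, Matrix.mul_assoc, hAY, ← Matrix.mul_assoc, hL, Matrix.one_mul]
  have hYX : Y * (E * X) = 1 := by
    have : (E * X) * Y = 1 := by rw [Matrix.mul_assoc, hXY, hED]
    exact mul_eq_one_comm.mp this
  have hAX : A = F * X := by
    calc A = A * (Y * (E * X)) := by rw [hYX, Matrix.mul_one]
      _ = F * ((D * E) * X) := by
        rw [← Matrix.mul_assoc, hAY]; simp only [Matrix.mul_assoc]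
      _ = F * X := by rw [hDE, Matrix.one_mul]
  have hWY : W = Y * Gᵀ := by
    calc W = (Y * (E * X)) * W := by rw [hYX, Matrix.one_mul]
      _ = Y * ((E * D) * Gᵀ) := by simp only [Matrix.mul_assoc, hXW]
      _ = Y * Gᵀ := by rw [hED, Matrix.one_mul]
  have hxa : ∀ l, √(X 1 l ^ 2 + X 2 l ^ 2) * c ≤ X 0 l := fun l =>
    sqrt_mul_cos_le_of_nonneg (N := N) (φ := 0) (by omega) fun i => by
      rw [← trigFrame_mul_apply, ← hF, ← hAX]
      exact hA i l
  have hyp : ∀ l, √(Y l 1 ^ 2 + Y l 2 ^ 2) * c ≤ Y l 0 := fun l =>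
    sqrt_mul_cos_le_of_nonneg (N := N) (φ := -(π / N)) (by omega) fun j => by
      have h := trigFrame_mul_apply (-(π / N)) Yᵀ j l
      simp only [transpose_apply] at h
      rw [← h, ← hG, ← transpose_transpose G, ← transpose_mul, ← hWY]
      exact hW l j
  have hdiag : ∀ l, Y l 0 * ((2 * c ^ 3)⁻¹ * X 0 l) + Y l 1 * X 1 l + Y l 2 * X 2 l = 1 := by
    intro l
    have h := congrFun (congrFun hYX l) l
    rw [one_apply_eq, Matrix.mul_apply, Fin.sum_univ_three] at h
    simpa [hE, diagonal_mul] using h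
  have hbound : ∀ l, 2 * c ^ 3 ≤ (1 + 2 * c) * (X 0 l * Y l 0) := by
    intro l
    have h1 := mul_add_mul_le_sqrt_mul_sqrt (Y l 1) (Y l 2) (X 1 l) (X 2 l)
    have h2 := mul_le_mul (hyp l) (hxa l) (by positivity)
      (le_trans (by positivity) (hyp l))
    have h3 := hdiag l
    have h4 : (Y l 1 * X 1 l + Y l 2 * X 2 l) * c ^ 2 ≤ Y l 0 * X 0 l := by nlinarith
    have h5 : Y l 0 * X 0 l + 2 * c * ((Y l 1 * X 1 l + Y l 2 * X 2 l) * c ^ 2) = 2 * c ^ 3 := by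
      rw [← mul_one (2 * c ^ 3), ← h3]
      field_simp
      ring
    nlinarith
  have hsum : X 0 0 * Y 0 0 + X 0 1 * Y 1 0 + X 0 2 * Y 2 0 = 2 * c ^ 3 := by
    have h := congrFun (congrFun hXY 0) 0
    rw [Matrix.mul_apply, Fin.sum_univ_three] at h
    simpa [hD] using h
  have h0 := hbound 0
  have h1 := hbound 1
  have h2 := hbound 2
  have h3 : 3 * (2 * c ^ 3) ≤ (1 + 2 * c) * (2 * c ^ 3) := by rw [← hsum] at h0 h1 h2 ⊢; linarith
  have h4 : 0 < 2 * c ^ 3 := by positivity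
  have := le_of_mul_le_mul_right h3 h4
  linarith

theorem HasNonnegFactorization.of_fintype {m n κ : Type*} [Fintype κ] {M : Matrix m n ℝ}
    (A : Matrix m κ ℝ) (W : Matrix κ n ℝ) (hA : ∀ i j, 0 ≤ A i j) (hW : ∀ i j, 0 ≤ W i j)
    (hM : M = A * W) : HasNonnegFactorization M (Fintype.card κ) :=
  ⟨A.submatrix id (Fintype.equivFin κ).symm, W.submatrix (Fintype.equivFin κ).symm id,
    fun _ _ => hA _ _, fun _ _ => hW _ _, by
      rw [submatrix_mul_equiv, submatrix_id_id, hM]⟩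

theorem HasNonnegFactorization.mono {m n : Type*} {M : Matrix m n ℝ} {k k' : ℕ}
    (h : HasNonnegFactorization M k) (hk : k ≤ k') : HasNonnegFactorization M k' := by
  obtain ⟨A, W, hA, hW, rfl⟩ := h
  obtain ⟨d, rfl⟩ := Nat.exists_eq_add_of_le hk
  refine ⟨Matrix.of fun i => Fin.append (A i) 0, Matrix.of fun l j => Fin.append (W · j) 0 l, ?_, ?_, ?_⟩
  · intro i l
    refine Fin.addCases (fun l => ?_) (fun l => ?_) l <;> simp [hA]
  · intro l j
    refine Fin.addCases (fun l => ?_) (fun l => ?_) l <;> simp [hW]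
  · ext i j
    simp [Matrix.mul_apply, Fin.sum_univ_add]

theorem four_le_of_hasNonnegFactorization_polygonSlack {N k : ℕ} (hN : 3 ≤ N)
    (h : HasNonnegFactorization (polygonSlack N) k) : 4 ≤ k := by
  by_contra! hk
  exact not_hasNonnegFactorization_polygonSlack_three hN (h.mono (by omega))

/-! ### The triangle that fits once few rows are kept. -/

theorem cos_nat_mul_le {N : ℕ} (hN : 2 ≤ N) {m : ℕ} (hm : 1 ≤ m) (hm' : m + 1 ≤ 2 * N) :
    cos (m * (π / N)) ≤ cos (π / N) := by
  have hN' : (2 : ℝ) ≤ N := by exact_mod_cast hN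
  have hx : 0 < π / N := by positivity
  have hxN : N * (π / N) = π := by field_simp
  have h1 : (1 : ℝ) ≤ m := by exact_mod_cast hm
  rcases le_total m N with h | h
  · have h' : (m : ℝ) ≤ N := by exact_mod_cast h
    exact cos_le_cos_of_nonneg_of_le_pi hx.le (by nlinarith) (by nlinarith)
  · have h' : (N : ℝ) ≤ m := by exact_mod_cast h
    have h2 : (m : ℝ) + 1 ≤ 2 * N := by exact_mod_cast hm'
    rw [← cos_two_pi_sub (m * (π / N))]
    exact cos_le_cos_of_nonneg_of_le_pi hx.le (by nlinarith) (by nlinarith)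

theorem cos_int_mul_le {N : ℕ} (hN : 2 ≤ N) {m : ℤ} (hm : ¬ (2 * (N : ℤ)) ∣ m) :
    cos (m * (π / N)) ≤ cos (π / N) := by
  have hN' : (0 : ℝ) < N := by exact_mod_cast (by omega : 0 < N)
  have h0 : 0 ≤ m % (2 * N) := Int.emod_nonneg _ (by omega)
  have h1 : m % (2 * N) < 2 * N := Int.emod_lt_of_pos _ (by omega)
  have h2 : m % (2 * N) ≠ 0 := fun h => hm (Int.dvd_of_emod_eq_zero h)
  have h3 := cos_nat_mul_le hN (m := (m % (2 * N)).toNat) (by omega) (by omega)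
  have h4 : (((m % (2 * N)).toNat : ℕ) : ℝ) = m - 2 * N * ((m / (2 * N) : ℤ) : ℝ) := by
    have : (((m % (2 * N)).toNat : ℕ) : ℤ) = m - 2 * N * (m / (2 * N)) := by
      rw [Int.toNat_of_nonneg h0, Int.emod_def]
    exact_mod_cast this
  rw [h4] at h3
  have h5 : ((m : ℝ) - 2 * N * ((m / (2 * N) : ℤ) : ℝ)) * (π / N)
      = m * (π / N) - ((m / (2 * N) : ℤ) : ℝ) * (2 * π) := by
    field_simp
  rwa [h5, cos_sub_int_mul_two_pi] at h3

/-- For `N ∤ m`, the cosine of `2mπ/N` is at most `cos² (π/N)`. -/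
theorem cos_two_mul_int_mul_le {N : ℕ} (hN : 3 ≤ N) {m : ℤ} (hm : ¬ (N : ℤ) ∣ m) :
    cos (2 * m * (π / N)) ≤ cos (π / N) ^ 2 := by
  have hN' : (3 : ℝ) ≤ N := by exact_mod_cast hN
  have h0 : 0 ≤ m % N := Int.emod_nonneg _ (by omega)
  have h1 : m % N < N := Int.emod_lt_of_pos _ (by omega)
  have h2 : m % N ≠ 0 := fun h => hm (Int.dvd_of_emod_eq_zero h)
  set k := (m % N).toNat with hk
  have h4 : (k : ℝ) = m - N * ((m / N : ℤ) : ℝ) := by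
    have : (k : ℤ) = m - N * (m / N) := by
      rw [hk, Int.toNat_of_nonneg h0, Int.emod_def]
    exact_mod_cast this
  have h5 : 2 * m * (π / N) = 2 * (k * (π / N)) + ((m / N : ℤ) : ℝ) * (2 * π) := by
    rw [h4]
    field_simp
    ring
  have hx : 0 < π / N := by positivity
  have hxN : N * (π / N) = π := by field_simp
  have hk1 : (1 : ℝ) ≤ k := by exact_mod_cast (by omega : 1 ≤ k)
  have hk2 : (k : ℝ) + 1 ≤ N := by exact_mod_cast (by omega : k + 1 ≤ N)
  -- This suffices: cos 2x = 1 - 2 sin² x ≤ 1 - sin²(π/N) at x = kπ/N.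
  have hsin : sin (π / N) ≤ sin (k * (π / N)) := by
    rw [← cos_pi_div_two_sub, ← cos_pi_div_two_sub, ← cos_abs (π / 2 - k * (π / N))]
    refine cos_le_cos_of_nonneg_of_le_pi (abs_nonneg _) (by linarith [pi_pos]) ?_
    rw [abs_le]
    constructor <;> nlinarith
  have hsin0 : 0 ≤ sin (π / N) := sin_nonneg_of_nonneg_of_le_pi hx.le (by nlinarith)
  rw [h5, cos_add_int_mul_two_pi, cos_two_mul]
  nlinarith [sin_sq_add_cos_sq (π / N), sin_sq_add_cos_sq (k * (π / N))]

theorem cos_two_pi_div_three : cos (2 * π / 3) = -1 / 2 := by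
  rw [show 2 * π / 3 = π - π / 3 by ring, cos_pi_sub, cos_pi_div_three]
  norm_num

theorem sin_two_pi_div_three : sin (2 * π / 3) = √3 / 2 := by
  rw [show 2 * π / 3 = π - π / 3 by ring, sin_pi_sub, sin_pi_div_three]

theorem sum_cos_equilateral (a : ℝ) :
    cos a + cos (a - 2 * π / 3) + cos (a - 2 * (2 * π / 3)) = 0 := by
  simp only [cos_sub, cos_two_mul, sin_two_mul, cos_two_pi_div_three, sin_two_pi_div_three]
  ring

theorem sum_cos_mul_cos_equilateral (a b : ℝ) :
    cos a * cos b + cos (a - 2 * π / 3) * cos (b - 2 * π / 3) +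
      cos (a - 2 * (2 * π / 3)) * cos (b - 2 * (2 * π / 3)) = 3 / 2 * cos (a - b) := by
  have h3 : √3 ^ 2 = 3 := sq_sqrt (by norm_num)
  simp only [cos_sub, cos_two_mul, sin_two_mul, cos_two_pi_div_three, sin_two_pi_div_three]
  ring_nf
  rw [h3]
  ring

/-- The triangle whose edge directions miss the rows in `J` gives a factorization. -/
theorem exists_factorization_polygonSlack {n N : ℕ} (hn : 2 ≤ n) (hN : N = 3 * n) (J : Finset (Fin N))
    (hJ : J.card < n) :
    ∃ (A : Matrix (Fin N) (Fin 3) ℝ) (W : Matrix (Fin 3) (Fin N) ℝ),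
      (∀ i ∈ J, ∀ l, 0 ≤ A i l) ∧ (∀ l j, 0 ≤ W l j) ∧ polygonSlack N = A * W := by
  classical
  obtain ⟨t, ht, htJ⟩ : ∃ t ∈ Finset.range n, t ∉ J.image fun i : Fin N => (i : ℕ) % n :=
    Finset.exists_mem_notMem_of_card_lt_card
      (by rw [Finset.card_range]; exact Finset.card_image_le.trans_lt hJ)
  have hc := cos_pi_div_pos (N := N) (by omega)
  have hn' : (0 : ℝ) < n := by exact_mod_cast (by omega : 0 < n)
  have hNr : (N : ℝ) = 3 * n := by rw [hN]; push_cast; ring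
  set c := cos (π / N) with hcdef
  -- The triangle has side normals at angles 2πt/N + 2πl/3, at distance c, and vertices of radius 2c
  -- opposite them. W holds slacks of the inner points against its sides, A scaled slacks of its
  -- vertices against the outer sides; only rows i ≡ t mod n can be negative.
  refine ⟨Matrix.of fun i l =>
      1 / 3 * (1 - cos (2 * π * i / N - 2 * π * t / N - l * (2 * π / 3)) / c ^ 2),
    Matrix.of fun l j => 2 * c ^ 2 *
      (c - cos (2 * π * j / N - π / N - 2 * π * t / N - l * (2 * π / 3))), ?_, ?_, ?_⟩
  · intro i hi l
    have h1 : 2 * π * i / N - 2 * π * t / N - l * (2 * π / 3)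
        = 2 * ((i - t - l * n : ℤ) : ℝ) * (π / N) := by
      rw [hNr]
      push_cast
      field_simp
    have h2 : ¬ (N : ℤ) ∣ (i - t - l * n : ℤ) := by
      intro h
      apply htJ
      rw [Finset.mem_image]
      refine ⟨i, hi, ?_⟩
      have h3 : (n : ℤ) ∣ (i : ℤ) - t := by
        have h4 : (n : ℤ) ∣ (i - t - l * n : ℤ) :=
          (Dvd.intro_left 3 (by rw [hN]; push_cast; ring)).trans h
        have h5 := dvd_add h4 (Dvd.intro_left (l : ℤ) rfl)
        simpa using h5
      have h6 : t ≡ i [MOD n] := (Nat.modEq_iff_dvd).2 h3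
      have h7 : t % n = i % n := h6
      rw [← h7, Nat.mod_eq_of_lt (Finset.mem_range.1 ht)]
    have h3 := cos_two_mul_int_mul_le (by omega) h2
    rw [← h1] at h3
    have h4 : cos (2 * π * i / N - 2 * π * t / N - l * (2 * π / 3)) / c ^ 2 ≤ 1 := by
      rw [div_le_one (by positivity)]
      exact h3
    simp only [Matrix.of_apply]
    linarith
  · intro l j
    have h1 : 2 * π * j / N - π / N - 2 * π * t / N - l * (2 * π / 3)
        = ((2 * (j - t - l * n) - 1 : ℤ) : ℝ) * (π / N) := by
      rw [hNr]
      push_cast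
      field_simp
      ring
    -- The half-step offset makes the multiple of π/N odd.
    have h2 := cos_int_mul_le (N := N) (by omega) (m := 2 * (j - t - l * n) - 1) (by
      intro h
      have : (2 : ℤ) ∣ 2 * (j - t - l * n) - 1 := (Dvd.intro _ rfl).trans h
      omega)
    rw [← h1] at h2
    simp only [Matrix.of_apply]
    have : 0 ≤ c - cos (2 * π * j / N - π / N - 2 * π * t / N - l * (2 * π / 3)) :=
      sub_nonneg.2 h2
    positivity
  · ext i j
    simp only [Matrix.mul_apply, Fin.sum_univ_three, Matrix.of_apply, polygonSlack, ← hcdef]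
    set a := 2 * π * i / N - 2 * π * t / N with ha
    set b := 2 * π * j / N - π / N - 2 * π * t / N with hb
    have hab : 2 * π * i / N - (2 * π * j / N - π / N) = a - b := by rw [ha, hb]; ring
    have e1 := sum_cos_equilateral a
    have e2 := sum_cos_equilateral b
    have e3 := sum_cos_mul_cos_equilateral a b
    rw [hab]
    simp only [Fin.val_zero, Fin.val_one, Fin.val_two, Nat.cast_zero, Nat.cast_one, Nat.cast_ofNat,
      zero_mul, one_mul, sub_zero]
    generalize cos (a - 2 * π / 3) = u, cos (a - 2 * (2 * π / 3)) = v,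
      cos (b - 2 * π / 3) = w, cos (b - 2 * (2 * π / 3)) = z at *
    field_simp
    linear_combination c * 2 * e1 + 2 * c ^ 2 * e2 - 2 * e3

/-! ### Block diagonal copies. -/

/-- The block diagonal matrix with `r` copies of `K`, reindexed along `e`. -/
def blockCopies {ι m : Type*} {r : ℕ} (e : ι ≃ Fin r × m) (K : Matrix m m ℝ) : Matrix ι ι ℝ :=
  Matrix.of fun x y => if (e x).1 = (e y).1 then K (e x).2 (e y).2 else 0

/-- Without cancellation, a term nonzero on two diagonal blocks would be nonzero off the diagonal;
so the blocks use disjoint sets of terms. -/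
theorem mul_le_of_hasNonnegFactorization_blockCopies {ι m : Type*} {r k d : ℕ}
    (e : ι ≃ Fin r × m) {K : Matrix m m ℝ} (hK : ∀ k, HasNonnegFactorization K k → d ≤ k)
    (h : HasNonnegFactorization (blockCopies e K) k) : d * r ≤ k := by
  classical
  obtain ⟨A, W, hA, hW, hM⟩ := h
  let S : Fin r → Finset (Fin k) := fun b => Finset.univ.filter fun l =>
    ∃ i j, A (e.symm (b, i)) l * W l (e.symm (b, j)) ≠ 0
  have hdisj : ∀ b ∈ Finset.univ, ∀ b' ∈ Finset.univ, b ≠ b' → Disjoint (S b) (S b') := by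
    intro b _ b' _ hbb
    rw [Finset.disjoint_left]
    intro l hl hl'
    obtain ⟨i, j', hi⟩ := (Finset.mem_filter.1 hl).2
    obtain ⟨i', j, hj⟩ := (Finset.mem_filter.1 hl').2
    have h0 := congrFun (congrFun hM (e.symm (b, i))) (e.symm (b', j))
    simp only [blockCopies, Matrix.of_apply, Equiv.apply_symm_apply, hbb, if_false,
      Matrix.mul_apply] at h0
    have h1 := (Finset.sum_eq_zero_iff_of_nonneg
      (fun l _ => mul_nonneg (hA (e.symm (b, i)) l) (hW l (e.symm (b', j))))).1 h0.symm l
      (Finset.mem_univ l)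
    rcases mul_eq_zero.1 h1 with h2 | h2
    · exact hi (by rw [h2, zero_mul])
    · exact hj (by rw [h2, mul_zero])
  have hcard : ∀ b, d ≤ (S b).card := by
    intro b
    rw [← Fintype.card_coe]
    refine hK _ (HasNonnegFactorization.of_fintype
      (Matrix.of fun i (l : S b) => A (e.symm (b, i)) l)
      (Matrix.of fun (l : S b) j => W l (e.symm (b, j))) (fun _ _ => hA _ _) (fun _ _ => hW _ _) ?_)
    ext i j
    have h0 := congrFun (congrFun hM (e.symm (b, i))) (e.symm (b, j))
    simp only [blockCopies, Matrix.of_apply, Equiv.apply_symm_apply, if_true,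
      Matrix.mul_apply] at h0
    simp only [Matrix.mul_apply, Matrix.of_apply]
    rw [h0, Finset.sum_coe_sort (S b) fun l => A (e.symm (b, i)) l * W l (e.symm (b, j))]
    symm
    refine Finset.sum_subset (Finset.subset_univ _) fun l _ hl => ?_
    by_contra hne
    exact hl (Finset.mem_filter.2 ⟨Finset.mem_univ _, i, j, hne⟩)
  calc d * r = ∑ _b : Fin r, d := by simp [mul_comm]
    _ ≤ ∑ b, (S b).card := Finset.sum_le_sum fun b _ => hcard b
    _ = (Finset.univ.biUnion S).card := (Finset.card_biUnion hdisj).symm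
    _ ≤ k := by simpa using Finset.card_le_univ (Finset.univ.biUnion S)

theorem hasNonnegFactorization_blockCopies_submatrix {ι m : Type*} [DecidableEq m] {r d n : ℕ}
    (e : ι ≃ Fin r × m) {K : Matrix m m ℝ}
    (hK : ∀ J : Finset m, J.card < n → ∃ (A : Matrix m (Fin d) ℝ) (W : Matrix (Fin d) m ℝ),
      (∀ i ∈ J, ∀ l, 0 ≤ A i l) ∧ (∀ l j, 0 ≤ W l j) ∧ K = A * W)
    (I : Finset ι) (hI : I.card < n) :
    HasNonnegFactorization ((blockCopies e K).submatrix (fun i : I => (i : ι)) id) (d * r) := by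
  -- Projecting all selected rows to one block leaves fewer than n, so one pair A, W serves every
  -- block.
  choose A W hA hW hM using
    hK (I.image fun x => (e x).2) (Finset.card_image_le.trans_lt hI)
  have hcard : d * r = Fintype.card (Fin d × Fin r) := by simp
  rw [hcard]
  refine HasNonnegFactorization.of_fintype
    (Matrix.of fun (x : I) (p : Fin d × Fin r) => if (e x).1 = p.2 then A (e x).2 p.1 else 0)
    (Matrix.of fun (p : Fin d × Fin r) y => if p.2 = (e y).1 then W p.1 (e y).2 else 0) ?_ ?_ ?_
  · intro x p
    simp only [Matrix.of_apply]
    split_ifs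
    · exact hA _ (Finset.mem_image_of_mem (fun x => (e x).2) x.2) _
    · exact le_rfl
  · intro p y
    simp only [Matrix.of_apply]
    split_ifs
    · exact hW _ _
    · exact le_rfl
  · ext x y
    have hK' : K (e x).2 (e y).2 = ∑ l, A (e x).2 l * W l (e y).2 := by
      rw [← Matrix.mul_apply, ← hM]
    rw [Matrix.mul_apply, Fintype.sum_prod_type]
    simp only [blockCopies, submatrix_apply, Matrix.of_apply, id]
    rw [hK']
    by_cases h : (e x).1 = (e y).1
    · simp [h]
    · simp [h]

theorem mainTheorem2 (r n : ℕ) (hn : 2 ≤ n) :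
    ∃ M : Matrix (Fin (3 * r * n)) (Fin (3 * r * n)) ℝ,
      (∀ i j, 0 ≤ M i j) ∧
      4 * r ≤ nonnegRank M ∧
      ∀ I : Finset (Fin (3 * r * n)), I.card < n →
        nonnegRank (M.submatrix (fun i : I => (i : Fin (3 * r * n))) id) ≤ 3 * r := by
  classical
  have hcard : 3 * r * n = r * (3 * n) := by ring
  let e : Fin (3 * r * n) ≃ Fin r × Fin (3 * n) := (finCongr hcard).trans finProdFinEquiv.symm
  have hnonneg : ∀ i j, 0 ≤ blockCopies e (polygonSlack (3 * n)) i j := by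
    intro i j
    simp only [blockCopies, Matrix.of_apply]
    split_ifs
    · exact polygonSlack_nonneg (by omega) _ _
    · exact le_rfl
  refine ⟨blockCopies e (polygonSlack (3 * n)), hnonneg, ?_, fun I hI => ?_⟩
  -- `hnonneg` ensures that the infimum is attained, not the default 0 of an empty set.
  · exact mul_le_of_hasNonnegFactorization_blockCopies e
      (fun k => four_le_of_hasNonnegFactorization_polygonSlack (by omega))
      (hasNonnegFactorization_nonnegRank _ hnonneg)
  · exact Nat.sInf_le (hasNonnegFactorization_blockCopies_submatrix e
      (exists_factorization_polygonSlack hn rfl) I hI)
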